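/- Let $G=(V,E)$ be a finite undirected loopless multigraph of order $n=|V|$ that is $2$-connected, meaning that $n\ge 2$, $G$ is connected, and $G$ has no cut vertex (so two vertices joined by one or more edges are allowed). The all-terminal reliability polynomial of $G$ is $$\mathrm{Rel}(G;q)=\sum_{F}(1-q)^{|F|}\,q^{|E|-|F|},$$ where the sum runs over all $F\subseteq E$ for which the spanning subgraph $(V,F)$ is connected; for $q\in[0,1]$ it is the probability that the operational edges connect all vertices when each edge fails independently with probability $q$. Then every complex root $z$ of $\mathrm{Rel}(G;q)$ satisfies $|z|\le n-1$. Moreover, if $n\ge 3$ and some vertex $w$ of $G$ has no incident multiple edges, that is, $w$ is joined to every other vertex by at most one edge (in particular, if $G$ is simple), then every complex root $z$ of $\mathrm{Rel}(G;q)$ satisfies $|z|\le n-2$. -/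

import Mathlib

open scoped Graph

namespace Graph

variable {α β : Type*}

/-- A multigraph is connected if it has a vertex and any two of its vertices are joined by a
walk. -/
def Connected (G : Graph α β) : Prop :=
  V(G).Nonempty ∧ ∀ x ∈ V(G), ∀ y ∈ V(G), Relation.ReflTransGen G.Adj x y

/-- A multigraph is 2-connected if it has at least two vertices, is connected, and has no
cut vertex. In particular two vertices joined by one or more edges form a 2-connected
multigraph. -/
def TwoConnected (G : Graph α β) : Prop :=
  2 ≤ V(G).ncard ∧ G.Connected ∧ ∀ v ∈ V(G), (G.deleteVerts {v}).Connected

/-- `w` has no incident multiple edges: no two distinct edges join `w` to the same vertex. -/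
def NoMultipleEdgesAt (G : Graph α β) (w : α) : Prop :=
  ∀ e f x, G.IsLink e w x → G.IsLink f w x → e = f

open Polynomial in
open scoped Classical in
/-- The all-terminal reliability polynomial `Rel(G; q)`: the sum, over all sets `F` of
operational edges for which the spanning subgraph with edge set `F` is connected, of the
probability `(1 - q) ^ |F| * q ^ (|E| - |F|)` that exactly the edges of `F` are operational, when
each edge fails independently with probability `q`. -/
noncomputable def reliability (G : Graph α β) (hE : E(G).Finite) : ℤ[X] :=
  ∑ F ∈ hE.toFinset.powerset.filter fun F : Finset β => (G.restrict (F : Set β)).Connected,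
    (1 - X) ^ F.card * X ^ (hE.toFinset.card - F.card)

end Graph

/-! Contracting edges joins partitions of the vertex set, so an edge set is connected when the join
of its edge partitions is `⊤`. Over a partition of corank `r` (classes minus one) the reliability is
`(1 - X) ^ r * H`. Conditioning on a parallel class of `m + 1` edges gives `H = X ^ (m + 1) * H₁ +
(1 + ⋯ + X ^ m) * H₂`, where `H₁` comes from deletion and `H₂` from contraction, of corank `r - 1`.
The geometric factor raises the bound on consecutive coefficient ratios by at most one
(`geom_sum_mul`), so inductively it is `r` (`exists_ratioBounded`), and Eneström–Kakeya gives `‖z‖ ≤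
r` for the roots of `H`; at `⊥`, `r = n - 1`.

If `w` has no multiple edges, the edges at `w` are conditioned on one at a time. Each is alone in
its parallel class, so no geometric factor appears, and deleting all of them leaves a disconnected
graph, with polynomial `0`. The bound `r - 1` survives (`exists_ratioBounded_pred`). -/

open Polynomial

/-! ### Coefficient ratios and the Eneström–Kakeya bound -/

/-- The coefficients of `H` are nonnegative, vanish above degree `d`, and up to degree `d` each is
at most `c` times the next one. -/
structure Polynomial.RatioBounded (c : ℕ) (d : ℤ) (H : ℤ[X]) : Prop where
  nonneg : ∀ k, 0 ≤ H.coeff k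
  eq_zero : ∀ k : ℕ, d < k → H.coeff k = 0
  le_mul : ∀ k : ℕ, (k : ℤ) < d → H.coeff k ≤ c * H.coeff (k + 1)

namespace Polynomial.RatioBounded

variable {c : ℕ} {d : ℤ} {H K : ℤ[X]}

theorem zero : RatioBounded c d 0 := ⟨by simp, by simp, by simp⟩

theorem one : RatioBounded c 0 1 := by
  refine ⟨fun k => ?_, fun k hk => ?_, fun k hk => ?_⟩
  · rw [coeff_one]; split_ifs <;> simp
  · rw [coeff_one, if_neg (by omega)]
  · omega

theorem add (h : RatioBounded c d H) (h' : RatioBounded c d K) : RatioBounded c d (H + K) := by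
  refine ⟨fun k => ?_, fun k hk => ?_, fun k hk => ?_⟩
  · rw [coeff_add]; exact add_nonneg (h.nonneg k) (h'.nonneg k)
  · rw [coeff_add, h.eq_zero k hk, h'.eq_zero k hk, add_zero]
  · rw [coeff_add, coeff_add, mul_add]; exact add_le_add (h.le_mul k hk) (h'.le_mul k hk)

theorem X_pow_mul (h : RatioBounded c d H) (m : ℕ) : RatioBounded c (d + m) (X ^ m * H) := by
  refine ⟨fun k => ?_, fun k hk => ?_, fun k hk => ?_⟩
  · rw [coeff_X_pow_mul']; split_ifs
    · exact h.nonneg _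
    · rfl
  · rw [coeff_X_pow_mul']; split_ifs
    · exact h.eq_zero _ (by omega)
    · rfl
  · rw [coeff_X_pow_mul', coeff_X_pow_mul']
    split_ifs with h1 h2
    · rw [Nat.sub_add_comm h1]; exact h.le_mul _ (by omega)
    · omega
    · exact mul_nonneg (by positivity) (h.nonneg _)
    · simp

theorem coeff_geom_sum_mul_nonneg (h : RatioBounded c d H) (m k : ℕ) :
    0 ≤ ((∑ i ∈ Finset.range m, X ^ i) * H).coeff k := by
  rw [Finset.sum_mul, finsetSum_coeff]
  exact Finset.sum_nonneg fun i _ => (h.X_pow_mul i).nonneg k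

/-- Telescoping gives `S_k + H_(k+1) = S_(k+1) + H_(k-m)`. Moreover `H_(k-m) ≤ c * H_(k-m+1) ≤ c *
S_(k+1)`, because `H_(k-m+1)` is one of the nonnegative summands of `S_(k+1)`. -/
theorem geom_sum_mul (h : RatioBounded c d H) (m : ℕ) :
    RatioBounded (c + 1) (d + m) ((∑ i ∈ Finset.range (m + 1), X ^ i) * H) := by
  refine ⟨h.coeff_geom_sum_mul_nonneg _, fun k hk => ?_, fun k hk => ?_⟩
  · rw [Finset.sum_mul, finsetSum_coeff]
    exact Finset.sum_eq_zero fun i hi =>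
      (h.X_pow_mul i).eq_zero k (by have := Finset.mem_range.1 hi; omega)
  · set S := (∑ i ∈ Finset.range (m + 1), X ^ i) * H with hS
    have hshift : X * S + H = S + X ^ (m + 1) * H := by
      have := mul_geom_sum (X : ℤ[X]) (m + 1)
      linear_combination H * this
    have h1 := congrArg (fun p => p.coeff (k + 1)) hshift
    simp only [coeff_add, coeff_X_mul, coeff_X_pow_mul'] at h1
    have h2 : S = (∑ i ∈ Finset.range m, X ^ i) * H + X ^ m * H := by
      rw [hS, Finset.sum_range_succ, add_mul]
    have h3 := congrArg (fun p => p.coeff (k + 1)) h2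
    simp only [coeff_add, coeff_X_pow_mul'] at h3
    have h4 := h.coeff_geom_sum_mul_nonneg m (k + 1)
    have h5 := h.coeff_geom_sum_mul_nonneg (m + 1) (k + 1)
    have h6 := h.nonneg (k + 1)
    rw [← hS] at h5
    have h7 : (0 : ℤ) ≤ c * S.coeff (k + 1) := by positivity
    push_cast
    rw [add_mul, one_mul]
    split_ifs at h1 with hm
    · rw [if_pos (by omega)] at h3
      have h8 := h.le_mul (k + 1 - (m + 1)) (by omega)
      rw [show k + 1 - (m + 1) + 1 = k + 1 - m by omega] at h8
      have h9 : (c : ℤ) * H.coeff (k + 1 - m) ≤ c * S.coeff (k + 1) :=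
        mul_le_mul_of_nonneg_left (by linarith) (by positivity)
      linarith
    · linarith

/-- The Eneström–Kakeya bound. -/
theorem norm_le_of_aeval_eq_zero (h : RatioBounded c d H) (hH : H ≠ 0) {z : ℂ}
    (hz : aeval z H = 0) : ‖z‖ ≤ c := by
  by_contra! hlt
  set n := H.natDegree with hn
  have hlead : 0 < H.coeff n :=
    lt_of_le_of_ne (h.nonneg n) (leadingCoeff_ne_zero.2 hH).symm
  have hnd : (n : ℤ) ≤ d := by
    by_contra! hd
    exact hlead.ne' (h.eq_zero n hd)
  have hr : 0 < ‖z‖ := lt_of_le_of_lt (by positivity) hlt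
  -- All coefficients in the subtracted bracket are nonnegative. Comparing this identity at `z` and
  -- at `‖z‖` through the triangle inequality gives `(‖z‖ - c) * H(‖z‖) ≤ 0`, whereas both factors
  -- are positive.
  have expand (t : ℂ) : (t - c) * aeval t H = H.coeff n * t ^ (n + 1)
      - (∑ k ∈ Finset.range n, ((c * H.coeff (k + 1) - H.coeff k : ℤ) : ℂ) * t ^ (k + 1)
        + c * H.coeff 0) := by
    have e1 : aeval t H = ∑ k ∈ Finset.range (n + 1), (H.coeff k : ℂ) * t ^ k := by
      rw [aeval_eq_sum_range]; simp [hn]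
    have e2 : t * aeval t H
        = ∑ k ∈ Finset.range n, (H.coeff k : ℂ) * t ^ (k + 1) + H.coeff n * t ^ (n + 1) := by
      rw [e1, Finset.mul_sum, ← Finset.sum_range_succ (fun k => (H.coeff k : ℂ) * t ^ (k + 1))]
      exact Finset.sum_congr rfl fun k _ => by ring
    have e3 : (c : ℂ) * aeval t H
        = ∑ k ∈ Finset.range n, (c * H.coeff (k + 1) : ℂ) * t ^ (k + 1) + c * H.coeff 0 := by
      rw [e1, Finset.sum_range_succ', mul_add, Finset.mul_sum]
      simp [mul_assoc]
    rw [sub_mul, e2, e3]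
    push_cast
    simp only [sub_mul, Finset.sum_sub_distrib]
    ring
  have hcoef (k) (hk : k ∈ Finset.range n) : 0 ≤ c * H.coeff (k + 1) - H.coeff k :=
    sub_nonneg.2 (h.le_mul k (by have := Finset.mem_range.1 hk; omega))
  have h1 := expand z
  rw [hz, mul_zero, eq_comm, sub_eq_zero] at h1
  have h2 : (H.coeff n : ℝ) * ‖z‖ ^ (n + 1)
      ≤ ∑ k ∈ Finset.range n, ((c * H.coeff (k + 1) - H.coeff k : ℤ) : ℝ) * ‖z‖ ^ (k + 1)
        + c * H.coeff 0 := by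
    have h3 := congrArg norm h1
    have hl : ‖(H.coeff n : ℂ) * z ^ (n + 1)‖ = (H.coeff n : ℝ) * ‖z‖ ^ (n + 1) := by
      rw [norm_mul, norm_pow, Complex.norm_intCast, abs_of_pos (by exact_mod_cast hlead)]
    rw [hl] at h3
    rw [h3]
    refine (norm_add_le _ _).trans (add_le_add ((norm_sum_le _ _).trans ?_) ?_)
    · refine Finset.sum_le_sum fun k hk => ?_
      rw [norm_mul, norm_pow, Complex.norm_intCast,
        abs_of_nonneg (by exact_mod_cast hcoef k hk)]
    · rw [norm_mul, Complex.norm_intCast, Complex.norm_natCast,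
        abs_of_nonneg (by exact_mod_cast h.nonneg 0)]
  have h4 := expand ((‖z‖ : ℝ) : ℂ)
  have h5 : aeval ((‖z‖ : ℝ) : ℂ) H = ((aeval ‖z‖ H : ℝ) : ℂ) := by
    rw [← Complex.coe_algebraMap, aeval_algebraMap_apply]
  rw [h5] at h4
  have h6 : (‖z‖ - c) * aeval ‖z‖ H = H.coeff n * ‖z‖ ^ (n + 1)
      - (∑ k ∈ Finset.range n, ((c * H.coeff (k + 1) - H.coeff k : ℤ) : ℝ) * ‖z‖ ^ (k + 1)
        + c * H.coeff 0) := by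
    exact_mod_cast h4
  have h7 : 0 < aeval ‖z‖ H := by
    rw [aeval_eq_sum_range]
    refine Finset.sum_pos' (fun k _ => ?_) ⟨n, by simp [hn], ?_⟩
    · have : (0 : ℝ) ≤ H.coeff k := by exact_mod_cast h.nonneg k
      simp only [zsmul_eq_mul]; positivity
    · have : (0 : ℝ) < H.coeff n := by exact_mod_cast hlead
      simp only [zsmul_eq_mul]; positivity
  have h8 : 0 < (‖z‖ - c) * aeval ‖z‖ H := mul_pos (by linarith) h7
  linarith

end Polynomial.RatioBounded

/-! ### Deletion–contraction in a semimodular lattice -/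

namespace SpanningSum

variable {L β : Type*} [SemilatticeSup L] [BoundedOrder L]

open scoped Classical in
/-- The probability, as a polynomial in the failure probability of an element, that the
operational elements of `E` generate `⊤` over `P`. -/
noncomputable def _root_.spanningSum (s : β → L) (P : L) (E : Finset β) : ℤ[X] :=
  ∑ F ∈ E.powerset with P ⊔ F.sup s = ⊤, (1 - X) ^ F.card * X ^ (E.card - F.card)

open scoped Classical in
/-- The number of elements of `E` that are not below `P`. -/
noncomputable def nonloopCard (s : β → L) (P : L) (E : Finset β) : ℕ :=
  (E.filter fun e => ¬ s e ≤ P).card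

variable {s : β → L} {P P' : L} {E Q D : Finset β} {e : β}

theorem insert_eq [DecidableEq β] (he : e ∉ E) : spanningSum s P (insert e E)
    = X * spanningSum s P E + (1 - X) * spanningSum s (P ⊔ s e) E := by
  simp only [spanningSum, Finset.sum_filter, Finset.sum_powerset_insert he, Finset.mul_sum]
  congr 1
  · refine Finset.sum_congr rfl fun F hF => ?_
    have hc := Finset.card_le_card (Finset.mem_powerset.1 hF)
    rw [mul_ite, mul_zero, Finset.card_insert_of_notMem he, Nat.sub_add_comm hc]
    congr 1
    ring
  · refine Finset.sum_congr rfl fun F hF => ?_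
    have heF : e ∉ F := fun h => he (Finset.mem_powerset.1 hF h)
    rw [mul_ite, mul_zero, Finset.card_insert_of_notMem he, Finset.card_insert_of_notMem heF,
      Finset.sup_insert, sup_assoc, Nat.add_sub_add_right]
    congr 1
    ring

theorem insert_of_le [DecidableEq β] (he : s e ≤ P) :
    spanningSum s P (insert e E) = spanningSum s P E := by
  by_cases h : e ∈ E
  · rw [Finset.insert_eq_of_mem h]
  · have := insert_eq (s := s) (P := P) h
    rw [sup_eq_left.2 he] at this
    convert this using 1
    ring

theorem union_of_le [DecidableEq β] (hQ : ∀ f ∈ Q, s f ≤ P) :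
    spanningSum s P (Q ∪ E) = spanningSum s P E := by
  induction Q using Finset.induction_on with
  | empty => simp
  | insert f Q hf ih =>
    rw [Finset.insert_union, insert_of_le (hQ f (by simp)),
      ih fun g hg => hQ g (Finset.mem_insert_of_mem hg)]

/-- All of `Q` fails with probability `X ^ Q.card`; otherwise any operational member of `Q` has the
effect of contracting the whole class. -/
theorem union_of_sup_eq [DecidableEq β] (hd : Disjoint Q E) (hQ : ∀ f ∈ Q, P ⊔ s f = P') :
    spanningSum s P (Q ∪ E)
      = X ^ Q.card * spanningSum s P E + (1 - X ^ Q.card) * spanningSum s P' E := by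
  induction Q using Finset.induction_on with
  | empty => simp
  | insert f Q hf ih =>
    rw [Finset.disjoint_insert_left] at hd
    have hQ' : ∀ g ∈ Q, P ⊔ s g = P' := fun g hg => hQ g (Finset.mem_insert_of_mem hg)
    have hfE : f ∉ Q ∪ E := by simp [hf, hd.1]
    have key := insert_eq (s := s) (P := P) hfE
    rw [hQ f (by simp), ih hd.2 hQ',
      union_of_le fun g hg => hQ' g hg ▸ le_sup_right] at key
    rw [Finset.insert_union, Finset.card_insert_of_notMem hf]
    convert key using 1
    ring

theorem eq_zero (h : P ⊔ E.sup s ≠ ⊤) : spanningSum s P E = 0 := by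
  classical
  refine Finset.sum_eq_zero fun F hF => (h ?_).elim
  rw [Finset.mem_filter, Finset.mem_powerset] at hF
  exact top_le_iff.1 (hF.2.symm.le.trans (sup_le_sup_left (Finset.sup_mono hF.1) _))

theorem top_eq_one : spanningSum s ⊤ E = 1 := by
  classical
  rw [← Finset.union_empty E, union_of_le fun _ _ => le_top]
  simp [spanningSum]

theorem eval_zero (h : P ⊔ E.sup s = ⊤) : (spanningSum s P E).eval 0 = 1 := by
  classical
  rw [spanningSum, eval_finsetSum, Finset.sum_eq_single E]
  · simp
  · intro F hF hne
    have hlt : F.card < E.card := Finset.card_lt_card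
      (Finset.ssubset_iff_subset_ne.2 ⟨Finset.mem_powerset.1 (Finset.mem_filter.1 hF).1, hne⟩)
    simp [Nat.sub_ne_zero_of_lt hlt]
  · intro hE
    simp [h] at hE

/-- A corank function on a semimodular lattice, whose values drop by one along each `s e`. -/
structure _root_.IsCorank (s : β → L) (ρ : L → ℕ) : Prop where
  strictAnti : StrictAnti ρ
  top : ρ ⊤ = 0
  sup : ∀ P e, ¬ s e ≤ P → ρ (P ⊔ s e) + 1 = ρ P

variable {ρ : L → ℕ}

/-- Both joins lower the corank by exactly one, so by strict monotonicity neither can lie strictly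
below the other. -/
theorem _root_.IsCorank.sup_eq_of_le (hρ : IsCorank s ρ) {f : β} (he : ¬ s e ≤ P) (hf : ¬ s f ≤ P)
    (h : s f ≤ P ⊔ s e) : P ⊔ s f = P ⊔ s e := by
  have hle : P ⊔ s f ≤ P ⊔ s e := sup_le le_sup_left h
  by_contra hne
  have := hρ.strictAnti (lt_of_le_of_ne hle hne)
  have := hρ.sup P e he
  have := hρ.sup P f hf
  omega

/-- Dividing the spanning polynomial by `(1 - X) ^ ρ P` leaves a polynomial whose consecutive
coefficients have ratio at most `ρ P`. -/
theorem exists_ratioBounded (hρ : IsCorank s ρ) (P : L) (E : Finset β) :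
    ∃ H, RatioBounded (ρ P) (nonloopCard s P E - ρ P) H ∧
      spanningSum s P E = (1 - X) ^ ρ P * H := by
  classical
  induction hn : E.card using Nat.strong_induction_on generalizing P E with
  | _ n ih =>
  subst hn
  by_cases hP : P = ⊤
  · subst hP
    refine ⟨1, ?_, ?_⟩
    · simpa [nonloopCard, hρ.top] using RatioBounded.one
    · simp [hρ.top, top_eq_one]
  by_cases hE : ∀ e ∈ E, s e ≤ P
  -- The degree bound is negative here, which forces a zero cofactor; hence degree bounds are
  -- integers.
  · refine ⟨0, RatioBounded.zero, ?_⟩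
    rw [mul_zero, eq_zero]
    rwa [sup_eq_left.2 (Finset.sup_le hE)]
  push Not at hE
  obtain ⟨e, heE, he⟩ := hE
  -- The parallel class of `e` over `P`. Removing it whole leaves the nonloops unchanged under
  -- contraction (`hN₂`), so the two degree bounds agree.
  set Q := E.filter fun f => ¬ s f ≤ P ∧ s f ≤ P ⊔ s e with hQdef
  have hQE : Q ⊆ E := Finset.filter_subset _ _
  have heQ : e ∈ Q := by simp [hQdef, heE, he]
  have hQ : ∀ f ∈ Q, P ⊔ s f = P ⊔ s e := fun f hf => by
    have := (Finset.mem_filter.1 hf).2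
    exact hρ.sup_eq_of_le he this.1 this.2
  have hlt : (E \ Q).card < E.card :=
    Finset.card_lt_card (Finset.sdiff_ssubset hQE ⟨e, heQ⟩)
  obtain ⟨H₁, hH₁, hS₁⟩ := ih _ hlt P (E \ Q) rfl
  obtain ⟨H₂, hH₂, hS₂⟩ := ih _ hlt (P ⊔ s e) (E \ Q) rfl
  have hc := hρ.sup P e he
  obtain ⟨m, hm⟩ : ∃ m, Q.card = m + 1 :=
    Nat.exists_eq_succ_of_ne_zero (Finset.card_ne_zero_of_mem heQ)
  have hN₁ : nonloopCard s P E = nonloopCard s P (E \ Q) + Q.card := by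
    rw [nonloopCard, nonloopCard, ← Finset.card_union_of_disjoint]
    · congr 1
      ext f
      simp only [hQdef, Finset.mem_filter, Finset.mem_union, Finset.mem_sdiff]
      tauto
    · exact Finset.disjoint_left.2 fun f hf hfQ =>
        (Finset.mem_sdiff.1 (Finset.mem_filter.1 hf).1).2 hfQ
  have hN₂ : nonloopCard s (P ⊔ s e) (E \ Q) = nonloopCard s P (E \ Q) := by
    rw [nonloopCard, nonloopCard]
    congr 1
    ext f
    simp only [hQdef, Finset.mem_filter, Finset.mem_sdiff]
    have : s f ≤ P → s f ≤ P ⊔ s e := le_sup_of_le_left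
    tauto
  refine ⟨X ^ Q.card * H₁ + (∑ i ∈ Finset.range (m + 1), X ^ i) * H₂, ?_, ?_⟩
  · refine RatioBounded.add ?_ ?_
    · convert hH₁.X_pow_mul Q.card using 1
      omega
    · rw [← hc]
      convert hH₂.geom_sum_mul m using 1
      omega
  · conv_lhs => rw [← Finset.union_sdiff_of_subset hQE]
    rw [union_of_sup_eq Finset.disjoint_sdiff hQ, hS₁, hS₂, hm, ← hc, ← mul_neg_geom_sum]
    ring

/-- If deleting `D` leaves a set that does not generate `⊤` and each element of `D` has no
parallel element in `E`, then the ratios of consecutive coefficients are at most `ρ P - 1`. -/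
theorem exists_ratioBounded_pred [DecidableEq β] (hρ : IsCorank s ρ) (P : L) (E D : Finset β)
    (hDE : D ⊆ E) (hD : P ⊔ (E \ D).sup s ≠ ⊤)
    (hpar : ∀ e ∈ D, ¬ s e ≤ P ∧ ∀ f ∈ E, ¬ s f ≤ P → s f ≤ P ⊔ s e → f = e) :
    ∃ H, RatioBounded (ρ P - 1) (nonloopCard s P E - ρ P) H ∧
      spanningSum s P E = (1 - X) ^ ρ P * H := by
  classical
  induction D using Finset.induction_on generalizing E with
  | empty =>
    refine ⟨0, RatioBounded.zero, ?_⟩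
    rw [mul_zero, eq_zero (by simpa using hD)]
  | insert e D heD ih =>
    have heE : e ∈ E := hDE (by simp)
    obtain ⟨he, hpe⟩ := hpar e (by simp)
    have hc := hρ.sup P e he
    obtain ⟨H₁, hH₁, hS₁⟩ := ih (E.erase e)
      (fun f hf => Finset.mem_erase.2 ⟨fun h => heD (h ▸ hf), hDE (Finset.mem_insert_of_mem hf)⟩)
      (by
        rwa [show E.erase e \ D = E \ insert e D by
          ext f
          simp only [Finset.mem_sdiff, Finset.mem_erase, Finset.mem_insert]
          tauto])
      fun g hg => ⟨(hpar g (Finset.mem_insert_of_mem hg)).1, fun f hf =>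
        (hpar g (Finset.mem_insert_of_mem hg)).2 f (Finset.mem_of_mem_erase hf)⟩
    obtain ⟨H₂, hH₂, hS₂⟩ := exists_ratioBounded hρ (P ⊔ s e) (E.erase e)
    have hN₁ : nonloopCard s P E = nonloopCard s P (E.erase e) + 1 := by
      rw [nonloopCard, nonloopCard, Finset.filter_erase, Finset.card_erase_add_one]
      exact Finset.mem_filter.2 ⟨heE, he⟩
    have hN₂ : nonloopCard s (P ⊔ s e) (E.erase e) = nonloopCard s P (E.erase e) := by
      rw [nonloopCard, nonloopCard]
      congr 1
      ext f
      simp only [Finset.mem_filter, Finset.mem_erase]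
      have h1 : s f ≤ P → s f ≤ P ⊔ s e := le_sup_of_le_left
      have h2 := hpe f
      tauto
    -- `H₂` already has ratio bound `ρ P - 1`, since contraction lowers the corank.
    refine ⟨X ^ 1 * H₁ + H₂, ?_, ?_⟩
    · refine RatioBounded.add ?_ ?_
      · convert hH₁.X_pow_mul 1 using 1
        push_cast
        omega
      · convert hH₂ using 1
        · omega
        · omega
    · have key := insert_eq (s := s) (P := P) (Finset.notMem_erase e E)
      rw [hS₁, hS₂, ← hc] at key
      rw [← Finset.insert_erase heE, ← hc]
      convert key using 1
      ring

end SpanningSum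

/-! ### Counting classes of partitions -/

namespace Setoid

variable {V : Type*}

/-- Identifying two classes of a setoid reduces the number of classes by one. -/
theorem card_quotient_sup_add_one [Finite V] {P T : Setoid V} {x y : V}
    (hT : ∀ R : Setoid V, T ≤ R ↔ R x y) (h : ¬ P x y) :
    Nat.card (Quotient (P ⊔ T)) + 1 = Nat.card (Quotient P) := by
  classical
  -- Redirecting the class of `y` to that of `x` realizes the join as a kernel, and the range misses
  -- only the class of `y`.
  let g : V → Quotient P := fun v => if P v y then Quotient.mk P x else Quotient.mk P v
  have hker : P ⊔ T = ker g := by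
    refine le_antisymm (sup_le (fun a b hab => ?_) ((hT _).2 ?_)) fun a b hab => ?_
    · have hiff : P a y ↔ P b y := ⟨P.trans' (P.symm' hab), P.trans' hab⟩
      rw [ker_def]
      simp only [g, hiff]
      split_ifs
      · rfl
      · exact Quotient.sound hab
    · rw [ker_def]
      simp only [g, if_neg h, if_pos (P.refl' y)]
    · have hP : P ≤ P ⊔ T := le_sup_left
      have hxy : (P ⊔ T) x y := (hT _).1 le_sup_right
      rw [ker_def] at hab
      simp only [g] at hab
      split_ifs at hab with h1 h2 h2
      · exact hP (P.trans' h1 (P.symm' h2))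
      · exact (P ⊔ T).trans' (hP h1) ((P ⊔ T).trans' ((P ⊔ T).symm' hxy)
          (hP (Quotient.exact hab)))
      · exact (P ⊔ T).trans' (hP (Quotient.exact hab)) ((P ⊔ T).trans' hxy (hP (P.symm' h2)))
      · exact hP (Quotient.exact hab)
  have hrange : Set.range g = {Quotient.mk P y}ᶜ := by
    ext q
    simp only [Set.mem_range, Set.mem_compl_iff, Set.mem_singleton_iff]
    constructor
    · rintro ⟨v, rfl⟩ hv
      simp only [g] at hv
      split_ifs at hv with h1
      · exact h (Quotient.exact hv)
      · exact h1 (Quotient.exact hv)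
    · induction q using Quotient.inductionOn with
      | _ v =>
        intro hv
        refine ⟨v, ?_⟩
        simp only [g]
        rw [if_neg fun h1 => hv (Quotient.sound h1)]
  rw [hker, Nat.card_congr (quotientKerEquivRange g), hrange, Nat.card_coe_set_eq,
    ← Set.ncard_singleton (Quotient.mk P y), add_comm, Set.ncard_add_ncard_compl]

theorem card_quotient_strictAnti [Finite V] :
    StrictAnti fun P : Setoid V => Nat.card (Quotient P) := by
  intro P Q hPQ
  have hle := hPQ.le
  let f : Quotient P → Quotient Q := Quotient.map' id fun _ _ h => hle h
  have hf : Function.Surjective f := fun q => by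
    induction q using Quotient.inductionOn with
    | _ v => exact ⟨Quotient.mk P v, rfl⟩
  refine lt_of_le_of_ne (Nat.card_le_card_of_surjective f hf) fun heq => hPQ.not_ge ?_
  have hbij := (Nat.bijective_iff_surjective_and_card f).2 ⟨hf, heq.symm⟩
  intro a b hab
  exact Quotient.exact (hbij.1 (show f (Quotient.mk P a) = f (Quotient.mk P b) from
    Quotient.sound hab))

end Setoid

/-! ### From multigraphs to the partition lattice -/

namespace Graph

variable {α β : Type*} {G : Graph α β}

/-- The partition of the vertex set whose only possibly nontrivial class consists of the ends
of `e`. -/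
def edgeSetoid (G : Graph α β) (e : β) : Setoid V(G) :=
  Relation.EqvGen.setoid fun x y => G.IsLink e x y

theorem edgeSetoid_le_iff {e : β} {R : Setoid V(G)} :
    G.edgeSetoid e ≤ R ↔ ∀ x y : V(G), G.IsLink e x y → R x y :=
  ⟨fun h x y hxy => h (Relation.EqvGen.rel x y hxy), Setoid.eqvGen_le⟩

theorem IsLink.edgeSetoid_le_iff {e : β} {x y : V(G)} (h : G.IsLink e x y) (R : Setoid V(G)) :
    G.edgeSetoid e ≤ R ↔ R x y := by
  rw [Graph.edgeSetoid_le_iff]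
  refine ⟨fun h' => h' x y h, fun hR a b hab => ?_⟩
  obtain ⟨h1, h2⟩ | ⟨h1, h2⟩ := hab.eq_and_eq_or_eq_and_eq h
  · rwa [Subtype.ext h1, Subtype.ext h2]
  · rw [Subtype.ext h1, Subtype.ext h2]
    exact R.symm' hR

theorem isCorank_edgeSetoid (hV : V(G).Finite) :
    IsCorank G.edgeSetoid fun P => Nat.card (Quotient P) - 1 := by
  have : Finite V(G) := hV
  have hsub (P : Setoid V(G)) {x y : V(G)} (h : ¬ P x y) : 1 < Nat.card (Quotient P) :=
    Finite.one_lt_card_iff_nontrivial.2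
      ⟨Quotient.mk P x, Quotient.mk P y, fun heq => h (Quotient.exact heq)⟩
  refine ⟨fun P Q hPQ => ?_, ?_, fun P e he => ?_⟩
  -- Truncated subtraction stays strict because `P` has at least two classes.
  · have h1 := Setoid.card_quotient_strictAnti hPQ
    obtain ⟨x, y, -, hxy⟩ : ∃ x y, Q x y ∧ ¬ P x y := by
      by_contra! h
      exact hPQ.not_ge fun x y => h x y
    have := hsub P hxy
    simp only at h1 ⊢
    omega
  · have : Subsingleton (Quotient (⊤ : Setoid V(G))) := Quotient.subsingleton_iff.2 rfl
    have := Finite.card_le_one_iff_subsingleton.2 this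
    omega
  · rw [Graph.edgeSetoid_le_iff] at he
    push Not at he
    obtain ⟨x, y, hxy, hP⟩ := he
    have h1 := Setoid.card_quotient_sup_add_one hxy.edgeSetoid_le_iff hP
    have h2 := hsub P hP
    omega

theorem restrict_connected_iff (hne : V(G).Nonempty) (F : Finset β) :
    (G.restrict (F : Set β)).Connected ↔ ⊥ ⊔ F.sup G.edgeSetoid = ⊤ := by
  rw [bot_sup_eq]
  constructor
  · rintro ⟨-, h⟩
    refine top_le_iff.1 fun x y _ => ?_
    have key : ∀ z, Relation.ReflTransGen (G.restrict (F : Set β)).Adj x z →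
        ∃ hz : z ∈ V(G), (F.sup G.edgeSetoid) x ⟨z, hz⟩ := fun z hz => by
      induction hz with
      | refl => exact ⟨x.2, Setoid.refl' _ _⟩
      | @tail a b _ hab ih =>
        obtain ⟨ha, hxa⟩ := ih
        obtain ⟨e, heF, he⟩ := hab
        refine ⟨he.right_mem, Setoid.trans' _ hxa ?_⟩
        exact Graph.edgeSetoid_le_iff.1 (Finset.le_sup (f := G.edgeSetoid) (Finset.mem_coe.1 heF))
          ⟨a, ha⟩ ⟨b, he.right_mem⟩ he
    exact (key y (h x x.2 y y.2)).2
  · intro h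
    refine ⟨hne, fun x hx y hy => ?_⟩
    let R : Setoid V(G) :=
      { r := fun a b => Relation.ReflTransGen (G.restrict (F : Set β)).Adj a b
        iseqv :=
          { refl := fun _ => .refl
            symm := fun hab =>
              have : Std.Symm (G.restrict (F : Set β)).Adj := ⟨fun _ _ ⟨e, he⟩ => ⟨e, he.symm⟩⟩
              Relation.ReflTransGen.stdSymm.symm _ _ hab
            trans := fun hab hbc => hab.trans hbc } }
    have hR : (⊤ : Setoid V(G)) ≤ R := h ▸ Finset.sup_le fun e he =>
      Graph.edgeSetoid_le_iff.2 fun a b hab => .single ⟨e, Finset.mem_coe.2 he, hab⟩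
    exact hR (x := ⟨x, hx⟩) (y := ⟨y, hy⟩) trivial

theorem reliability_eq_spanningSum (hne : V(G).Nonempty) (hE : E(G).Finite) :
    G.reliability hE = spanningSum G.edgeSetoid ⊥ hE.toFinset := by
  classical
  rw [reliability, spanningSum]
  refine Finset.sum_congr (Finset.filter_congr fun F _ => ?_) fun _ _ => rfl
  exact restrict_connected_iff hne F

theorem corank_bot : Nat.card (Quotient (⊥ : Setoid V(G))) - 1 = V(G).ncard - 1 := by
  rw [Nat.card_congr Setoid.quotientBotEquiv, Nat.card_coe_set_eq]

theorem Connected.bot_sup_eq_top (hG : G.Connected) (hE : E(G).Finite) :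
    ⊥ ⊔ hE.toFinset.sup G.edgeSetoid = ⊤ := by
  rw [← restrict_connected_iff hG.1, hE.coe_toFinset]
  refine ⟨hG.1, fun x hx y hy => Relation.ReflTransGen.mono ?_ _ _ (hG.2 x hx y hy)⟩
  rintro a b ⟨e, he⟩
  exact ⟨e, he.edge_mem, he⟩

/-- A root of the reliability polynomial is `1` or a root of the cofactor of a power of
`1 - X`. -/
theorem Connected.norm_le_of_aeval_reliability_eq_zero (hG : G.Connected) (hE : E(G).Finite)
    {c r : ℕ} {d : ℤ} {H : ℤ[X]} (hc : 1 ≤ c) (hH : RatioBounded c d H)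
    (hS : spanningSum G.edgeSetoid ⊥ hE.toFinset = (1 - X) ^ r * H) {z : ℂ}
    (hz : aeval z (G.reliability hE) = 0) : ‖z‖ ≤ c := by
  rw [reliability_eq_spanningSum hG.1, hS] at hz
  -- At failure probability `0` the reliability is `1`.
  have hH0 : H ≠ 0 := by
    rintro rfl
    have := SpanningSum.eval_zero (hG.bot_sup_eq_top hE)
    simp [hS] at this
  simp only [map_mul, map_pow, map_sub, map_one, aeval_X, mul_eq_zero] at hz
  obtain hz | hz := hz
  · have h1 : z = 1 := (sub_eq_zero.1 (eq_zero_of_pow_eq_zero hz)).symm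
    rw [h1, norm_one]
    exact_mod_cast hc
  · exact hH.norm_le_of_aeval_eq_zero hH0 hz

/-- The edges at a vertex `w` without incident multiple edges have no parallel edges, and deleting
them isolates `w`. -/
theorem NoMultipleEdgesAt.exists_ratioBounded (hV : V(G).Finite) (hE : E(G).Finite)
    (hloop : G.Loopless) (hcard : 2 ≤ V(G).ncard) {w : α} (hw : w ∈ V(G))
    (hmult : G.NoMultipleEdgesAt w) :
    ∃ d H, RatioBounded (V(G).ncard - 2) d H ∧
      spanningSum G.edgeSetoid ⊥ hE.toFinset = (1 - X) ^ (V(G).ncard - 1) * H := by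
  classical
  have hρ := isCorank_edgeSetoid hV
  set D := hE.toFinset.filter fun e => G.Inc e w
  have hends {e : β} {x y : V(G)} (he : G.IsLink e x y) : x ≠ y := fun hxy =>
    G.not_isLoopAt e x (by subst hxy; exact he)
  have hspan : ⊥ ⊔ (hE.toFinset \ D).sup G.edgeSetoid ≠ ⊤ := by
    intro htop
    obtain ⟨v, hv, hvw⟩ := Set.exists_ne_of_one_lt_ncard (by omega : 1 < V(G).ncard) w
    -- The partition into `{w}` and the other vertices lies above every edge not at `w`.
    let R : Setoid V(G) := Setoid.ker fun x => (x : α) = w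
    have hR : (⊤ : Setoid V(G)) ≤ R := by
      rw [← htop, bot_sup_eq]
      refine Finset.sup_le fun e he => Graph.edgeSetoid_le_iff.2 fun a b hab => ?_
      have hinc : ¬ G.Inc e w := fun hi => (Finset.mem_sdiff.1 he).2
        (Finset.mem_filter.2 ⟨(Finset.mem_sdiff.1 he).1, hi⟩)
      have ha : (a : α) ≠ w := fun h => hinc ⟨b, h ▸ hab⟩
      have hb : (b : α) ≠ w := fun h => hinc ⟨a, h ▸ hab.symm⟩
      rw [Setoid.ker_def]
      simp [ha, hb]
    have := Setoid.ker_def.1 (hR (x := ⟨v, hv⟩) (y := ⟨w, hw⟩) trivial)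
    simp [hvw] at this
  have hpar : ∀ e ∈ D, ¬ G.edgeSetoid e ≤ ⊥ ∧ ∀ f ∈ hE.toFinset, ¬ G.edgeSetoid f ≤ ⊥ →
      G.edgeSetoid f ≤ ⊥ ⊔ G.edgeSetoid e → f = e := by
    intro e he
    obtain ⟨y, hwy⟩ := (Finset.mem_filter.1 he).2
    have hwy' : G.IsLink e (⟨w, hw⟩ : V(G)) (⟨y, hwy.right_mem⟩ : V(G)) := hwy
    refine ⟨fun hle => hends hwy' ((hwy'.edgeSetoid_le_iff ⊥).1 hle), fun f hf _ hle => ?_⟩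
    obtain ⟨a, b, hab⟩ := G.exists_isLink_of_mem_edgeSet (hE.mem_toFinset.1 hf)
    have hab' : G.IsLink f (⟨a, hab.left_mem⟩ : V(G)) (⟨b, hab.right_mem⟩ : V(G)) := hab
    have hne := hends hab'
    rw [ne_eq, Subtype.mk.injEq] at hne
    -- Merging `y` into `w` contracts `e`; an edge collapsed by this must join `w` and `y`.
    let R : Setoid V(G) := Setoid.ker fun x => if (x : α) = y then w else x
    have heR : G.edgeSetoid e ≤ R := (hwy'.edgeSetoid_le_iff R).2 <| by
      rw [Setoid.ker_def]
      simp
    have := Setoid.ker_def.1 <| (hab'.edgeSetoid_le_iff R).1 <|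
      hle.trans (by rw [bot_sup_eq]; exact heR)
    simp only at this
    split_ifs at this with h1 h2 h2
    · exact absurd (h1.trans h2.symm) hne
    · exact hmult f e y (by rw [this, ← h1]; exact hab.symm) hwy
    · exact hmult f e y (by rw [← this, ← h2]; exact hab) hwy
    · exact absurd this hne
  obtain ⟨H, hH, hS⟩ := SpanningSum.exists_ratioBounded_pred hρ ⊥ hE.toFinset D
    (Finset.filter_subset _ _) hspan hpar
  rw [corank_bot, Nat.sub_sub] at hH
  exact ⟨_, H, hH, by rw [hS, corank_bot]⟩

end Graph

theorem theorem1 {α β : Type*} (G : Graph α β) (hV : V(G).Finite) (hE : E(G).Finite)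
    (hloop : G.Loopless) (hG : G.TwoConnected) :
    (∀ z : ℂ, Polynomial.aeval z (G.reliability hE) = 0 → ‖z‖ ≤ (V(G).ncard : ℝ) - 1) ∧
    (3 ≤ V(G).ncard → (∃ w ∈ V(G), G.NoMultipleEdgesAt w) →
      ∀ z : ℂ, Polynomial.aeval z (G.reliability hE) = 0 → ‖z‖ ≤ (V(G).ncard : ℝ) - 2) ∧
    (3 ≤ V(G).ncard → G.Simple →
      ∀ z : ℂ, Polynomial.aeval z (G.reliability hE) = 0 → ‖z‖ ≤ (V(G).ncard : ℝ) - 2) := by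
  have hcard := hG.1
  have hconn := hG.2.1
  have key : 3 ≤ V(G).ncard → (∃ w ∈ V(G), G.NoMultipleEdgesAt w) →
      ∀ z : ℂ, Polynomial.aeval z (G.reliability hE) = 0 → ‖z‖ ≤ (V(G).ncard : ℝ) - 2 := by
    rintro h3 ⟨w, hw, hmult⟩ z hz
    obtain ⟨d, H, hH, hS⟩ := hmult.exists_ratioBounded hV hE hloop hcard hw
    -- The root `1` from the power of `1 - X` requires `n - 2 ≥ 1`, hence `n ≥ 3`.
    have := hconn.norm_le_of_aeval_reliability_eq_zero hE (by omega) hH hS hz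
    rwa [Nat.cast_sub hcard] at this
  refine ⟨fun z hz => ?_, key, fun h3 hs => key h3 ?_⟩
  · obtain ⟨H, hH, hS⟩ := SpanningSum.exists_ratioBounded (Graph.isCorank_edgeSetoid hV) ⊥
      hE.toFinset
    rw [Graph.corank_bot] at hH
    have := hconn.norm_le_of_aeval_reliability_eq_zero hE (by omega) hH hS hz
    rwa [Nat.cast_sub (by omega), Nat.cast_one] at this
  · obtain ⟨w, hw⟩ := hconn.1
    exact ⟨w, hw, fun e f x he hf => hs.eq_of_isLink he hf⟩
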